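/- Let $E$ be a countable set of events, each belonging to a participant given by $\pi:E\to\mathcal A$. A CES (event structure with circular causality) on $E$ consists of an irreflexive symmetric conflict relation $\#$ and of two relations $\vdash,\Vdash$ between finite conflict-free subsets of $E$ and events, both saturated ($X\circ e$, $X\subseteq Y$ with $Y$ finite and conflict-free imply $Y\circ e$); for an infinite conflict-free $X$, $X\circ e$ means $Y\circ e$ for some finite $Y\subseteq X$. It is conflict-free if $\#=\emptyset$. A play is a finite or infinite conflict-free sequence $\sigma=e_0e_1\cdots$ of events without repetitions; $\overline\sigma$ is its set of events and $\sigma_i=e_0\cdots e_{i-1}$, with $\sigma_i=\sigma$ for $i\ge|\sigma|$. The credits of $\sigma$ are $\Gamma(\sigma)=\{e_i : \overline{\sigma_i}\not\vdash e_i \text{ and } \overline\sigma\not\Vdash e_i\}$. A strategy for a participant $A$ maps each finite play $\sigma$ to a set $\Sigma(\sigma)\subseteq\pi^{-1}(A)$ such that $\sigma e$ is a play for all $e\in\Sigma(\sigma)$. A play $\sigma$ conforms to $\Sigma$ if $e_i\in\pi^{-1}(A)$ implies $e_i\in\Sigma(\sigma_i)$, for all $i$; it is fair for $\Sigma$ if,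 for all $e$ and $i$, whenever $e\in\Sigma(\sigma_j)$ for all $j\ge i$, there is $h\ge i$ with $e_h=e$. The following notions are defined by mutual recursion, prudence of events being the greatest solution (the recursion is monotone in it): * a strategy $\Sigma$ for $A$ with past $\sigma$ (a finite play conforming to $\Sigma$) is prudent if for every play $\sigma'$ that extends $\sigma$, conforms to $\Sigma$, is fair for $\Sigma$, and in which all $B\ne A$ are innocent, there is $k>|\sigma|$ with $\Gamma(\sigma'_k)\cap\pi^{-1}(A)\subseteq\Gamma(\sigma)$; * an event $e$ is prudent in the finite play $\sigma$ if $e\in\Sigma(\sigma)$ for some prudent strategy $\Sigma$ with past $\sigma$; * $B$ is innocent in $\sigma$ if for all $e\in\pi^{-1}(B)$ and all $i$ there is $j\ge i$ such that $e$ is not prudent in $\sigma_j$. For $X\subseteq E$ let $$\mathcal R(X)=\{e\notin X : \text{there is a play } \sigma\eta,\ \sigma \text{ finite},\ \text{with } \overline\sigma=X,\ e\in\overline\eta,\ \Gamma(\sigma\eta)\subseteq X\},$$ $$\mathcal U(X)=\{e\notin X : X\vdash e\ \text{ or }\ X\cup\mathcal R(X)\Vdash e\}.$$ **Lemma.** (1)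 Let the CES be conflict-free, and let only finitely many events $e$ satisfy $Z\Vdash e$ for some $Z$ (in particular, $E$ may be any finite set). Then for every finite play $\sigma$ and every event $e$: $e$ is prudent in $\sigma$ if and only if $e\in\mathcal U(\overline\sigma)$. (2) $\mathcal U(X)$ is computable in polynomial time: there are a single program and a polynomial $p$ such that, for every $n$, every conflict-free CES on $n$ numbered events, and every set $X$ of events, the program on input $X$ halts after at most $p(n)$ steps with output $\mathcal U(X)$. Here programs are while programs with finitely many registers, each holding a natural number or a set of events. The elementary steps set a number register to $0$, increment it, insert into or remove from a set register the event with the number in a number register, do nothing, or test, for an event number $i$ and a set register $S$, one of $i<n$, $i\in S$, $S\vdash i$, $S\Vdash i$; each costs one step. -/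

import Mathlib

/-- An event structure with circular causality over the events `E`: a conflict relation, an
enabling relation `enab` (`X ⊢ e`) and a circular enabling relation `circ` (`X ⊩ e`), both
relating finite conflict-free sets of events to events, and both saturated. -/
structure CES (E : Type*) where
  conflict : E → E → Prop
  conflict_irrefl : ∀ e, ¬ conflict e e
  conflict_symm : ∀ a b, conflict a b → conflict b a
  enab : Finset E → E → Prop
  circ : Finset E → E → Prop
  enab_con : ∀ X e, enab X e → ∀ a ∈ X, ∀ b ∈ X, ¬ conflict a b
  circ_con : ∀ X e, circ X e → ∀ a ∈ X, ∀ b ∈ X, ¬ conflict a b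
  enab_saturated : ∀ X Y e, X ⊆ Y → enab X e →
    (∀ a ∈ Y, ∀ b ∈ Y, ¬ conflict a b) → enab Y e
  circ_saturated : ∀ X Y e, X ⊆ Y → circ X e →
    (∀ a ∈ Y, ∀ b ∈ Y, ¬ conflict a b) → circ Y e

namespace CES

variable {E A : Type*} (M : CES E)

/-- `CF X`: the set of events `X` is conflict-free. -/
def CF (X : Set E) : Prop := ∀ a ∈ X, ∀ b ∈ X, ¬ M.conflict a b

/-- The whole structure is conflict-free: its conflict relation is empty. -/
def ConflictFree : Prop := ∀ a b, ¬ M.conflict a b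

/-- `X ⊢ e` for an arbitrary set `X` of events. On finite sets this is `M.enab` (lemma
`enables_coe` below). -/
def Enables (X : Set E) (e : E) : Prop :=
  M.CF X ∧ ∃ Y : Finset E, (Y : Set E) ⊆ X ∧ M.enab Y e

/-- `X ⊩ e` for an arbitrary set `X` of events. On finite sets this is `M.circ` (lemma
`circEnables_coe` below). -/
def CircEnables (X : Set E) (e : E) : Prop :=
  M.CF X ∧ ∃ Y : Finset E, (Y : Set E) ⊆ X ∧ M.circ Y e

theorem enables_coe (X : Finset E) (e : E) : M.Enables (X : Set E) e ↔ M.enab X e := by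
  constructor
  · rintro ⟨h, Y, hY, hYe⟩
    exact M.enab_saturated Y X e (by exact_mod_cast hY) hYe
      (fun a ha b hb => h a (by exact_mod_cast ha) b (by exact_mod_cast hb))
  · intro h
    exact ⟨fun a ha b hb => M.enab_con X e h a (by exact_mod_cast ha) b (by exact_mod_cast hb),
      X, subset_rfl, h⟩

theorem circEnables_coe (X : Finset E) (e : E) :
    M.CircEnables (X : Set E) e ↔ M.circ X e := by
  constructor
  · rintro ⟨h, Y, hY, hYe⟩
    exact M.circ_saturated Y X e (by exact_mod_cast hY) hYe
      (fun a ha b hb => h a (by exact_mod_cast ha) b (by exact_mod_cast hb))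
  · intro h
    exact ⟨fun a ha b hb => M.circ_con X e h a (by exact_mod_cast ha) b (by exact_mod_cast hb),
      X, subset_rfl, h⟩

/-- The set of events occurring in a finite or infinite sequence. -/
def events (σ : Stream'.Seq E) : Set E := {e | ∃ i, σ.get? i = some e}

/-- A play: a finite or infinite conflict-free sequence of events without repetitions.
Finite plays are lists, coerced to sequences. -/
def IsPlay (σ : Stream'.Seq E) : Prop :=
  (∀ i j e, σ.get? i = some e → σ.get? j = some e → i = j) ∧ M.CF (events σ)

/-- The events done on credit in a finite or infinite sequence `σ = e₀ e₁ …`: those `eᵢ` which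
are neither `⊢`-enabled by the events of `σᵢ = e₀ … eᵢ₋₁`, nor `⊩`-enabled by all the events
of `σ`. The prefix `σᵢ` is `σ.take i`, which is the whole of `σ` when `i` is at least the
length of `σ`. -/
def credits (σ : Stream'.Seq E) : Set E :=
  {e | ∃ i, σ.get? i = some e ∧
    ¬ M.Enables (events (σ.take i : Stream'.Seq E)) e ∧ ¬ M.CircEnables (events σ) e}

/-- `S` is a strategy for `a`: it associates to each finite play a set of events of `a`, each
of which extends the play to a play. (The values of `S` on lists that are not plays are never
used.) -/
def IsStrategy (π : E → A) (a : A) (S : List E → Set E) : Prop :=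
  ∀ σ : List E, M.IsPlay σ → ∀ e ∈ S σ, π e = a ∧ M.IsPlay ((σ ++ [e] : List E) : Stream'.Seq E)

/-- The sequence `σ` conforms to the strategy `S` for `a`. -/
def Conforms (π : E → A) (a : A) (S : List E → Set E) (σ : Stream'.Seq E) : Prop :=
  ∀ i e, σ.get? i = some e → π e = a → e ∈ S (σ.take i)

/-- The sequence `σ` is fair with respect to `S`: no event is perpetually enabled by `S` from
some point on without being performed. Since `σ.take j = σ` for all `j` beyond the length of
`σ`, the indices need not be bounded by the length. -/
def Fair (S : List E → Set E) (σ : Stream'.Seq E) : Prop :=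
  ∀ e i, (∀ j, i ≤ j → e ∈ S (σ.take j)) → ∃ h, i ≤ h ∧ σ.get? h = some e

/-- Participant `b` is innocent in `σ`, when `P τ e` is read as "`e` is prudent in `τ`". -/
def InnocentWrt (P : List E → E → Prop) (π : E → A) (b : A) (σ : Stream'.Seq E) : Prop :=
  ∀ e, π e = b → ∀ i, ∃ j, i ≤ j ∧ ¬ P (σ.take j) e

/-- The strategy `S` for `a`, with past `σ`, is prudent, when `P τ e` is read as "`e` is prudent
in `τ`". The play `σ'` extends `σ` when its first `σ.length` events are those of `σ`. -/
def PrudentStrategyWrt (P : List E → E → Prop) (π : E → A) (a : A) (S : List E → Set E)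
    (σ : List E) : Prop :=
  M.IsStrategy π a S ∧ Conforms π a S σ ∧
  ∀ σ' : Stream'.Seq E, M.IsPlay σ' → σ'.take σ.length = σ → Conforms π a S σ' → Fair S σ' →
    (∀ b, b ≠ a → InnocentWrt P π b σ') →
    ∃ k, σ.length < k ∧
      M.credits (σ'.take k : Stream'.Seq E) ∩ {e | π e = a} ⊆ M.credits (σ : Stream'.Seq E)

/-- The operator whose greatest fixed point is prudence: `e` is prudent in the finite play `σ`
if some prudent strategy with past `σ`, for the participant of `e`, prescribes `e` in `σ`. It is
monotone, since `P` occurs negatively in innocence and innocence is an assumption in the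
prudence of strategies. -/
def prudenceStep (π : E → A) : (List E → E → Prop) →o (List E → E → Prop) where
  toFun P σ e := M.IsPlay σ ∧ ∃ S, M.PrudentStrategyWrt P π (π e) S σ ∧ e ∈ S σ
  monotone' := by
    rintro P Q hPQ σ e ⟨hσ, S, ⟨hS, hc, h⟩, he⟩
    refine ⟨hσ, S, ⟨hS, hc, fun σ' h1 h2 h3 h4 h5 => h σ' h1 h2 h3 h4 ?_⟩, he⟩
    intro b hb e' he' i
    obtain ⟨j, hj, hn⟩ := h5 b hb e' he' i
    exact ⟨j, hj, fun hp => hn (hPQ _ _ hp)⟩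

/-- The event `e` is prudent in the finite play `σ`. Prudence is the coinductive solution of the
mutually recursive definitions of prudent events, prudent strategies and innocent
participants. -/
def Prudent (π : E → A) (σ : List E) (e : E) : Prop :=
  OrderHom.gfp (M.prudenceStep π) σ e

/-- Prudent strategies, for the actual notion of prudent events. -/
def PrudentStrategy (π : E → A) (a : A) (S : List E → Set E) (σ : List E) : Prop :=
  M.PrudentStrategyWrt (M.Prudent π) π a S σ

theorem prudent_iff (π : E → A) (σ : List E) (e : E) :
    M.Prudent π σ e ↔ M.IsPlay σ ∧ ∃ S, M.PrudentStrategy π (π e) S σ ∧ e ∈ S σ := by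
  have h := (M.prudenceStep π).map_gfp
  have h2 := congrFun (congrFun h σ) e
  exact Iff.of_eq h2.symm

/-- The events reachable with past `X`: those `e ∉ X` that occur in some play `σ η` such that
`σ` is a linearization of `X` and the credits of `σ η` are contained in `X`. -/
def reach (X : Set E) : Set E :=
  {e | e ∉ X ∧ ∃ (σ : List E) (η : Stream'.Seq E),
    M.IsPlay ((σ : Stream'.Seq E).append η) ∧ events (σ : Stream'.Seq E) = X ∧
    e ∈ events η ∧ M.credits ((σ : Stream'.Seq E).append η) ⊆ X}

/-- The criterion: the events `e ∉ X` such that `X ⊢ e` or `X ∪ reach X ⊩ e`. -/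
def criterion (X : Set E) : Set E :=
  {e | e ∉ X ∧ (M.Enables X e ∨ M.CircEnables (X ∪ M.reach X) e)}

end CES

/-! A cost model for algorithms on event structures with events `0, …, n - 1`: while programs
with index registers, holding natural numbers, and set registers, holding sets of events, which
access the event structure only by testing enablings. Every elementary instruction and every
evaluation of a test costs one step. -/

namespace CESProg

/-- Tests: is the index in register `i` less than the number of events; does set register `s`
contain event number `i`; does it `⊢`-enable it; does it `⊩`-enable it. -/
inductive Test where
  | inRange (i : ℕ)
  | mem (s i : ℕ)
  | enab (s i : ℕ)
  | circ (s i : ℕ)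

/-- Programs. The elementary instructions set an index register to zero, increment it, and
insert into or erase from a set register the event whose number is in an index register. -/
inductive Cmd where
  | skip
  | zero (i : ℕ)
  | succ (i : ℕ)
  | insert (s i : ℕ)
  | erase (s i : ℕ)
  | seq (c d : Cmd)
  | cond (t : Test) (c d : Cmd)
  | loop (t : Test) (c : Cmd)

/-- The contents of the index registers and of the set registers. -/
structure State where
  idx : ℕ → ℕ
  set : ℕ → Set ℕ

/-- The truth value of a test in a state, on the event structure `M`. -/
def Test.Holds {n : ℕ} (M : CES (Fin n)) (st : State) : Test → Prop
  | .inRange i => st.idx i < n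
  | .mem s i => st.idx i ∈ st.set s
  | .enab s i => ∃ h : st.idx i < n, M.Enables {x | (x : ℕ) ∈ st.set s} ⟨st.idx i, h⟩
  | .circ s i => ∃ h : st.idx i < n, M.CircEnables {x | (x : ℕ) ∈ st.set s} ⟨st.idx i, h⟩

/-- `Runs M c st k st'`: on the event structure `M`, the program `c` started in state `st` halts
after `k` steps in state `st'`. -/
inductive Runs {n : ℕ} (M : CES (Fin n)) : Cmd → State → ℕ → State → Prop where
  | skip (st) : Runs M .skip st 1 st
  | zero (i st) : Runs M (.zero i) st 1 ⟨Function.update st.idx i 0, st.set⟩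
  | succ (i st) : Runs M (.succ i) st 1 ⟨Function.update st.idx i (st.idx i + 1), st.set⟩
  | insert (s i st) : Runs M (.insert s i) st 1
      ⟨st.idx, Function.update st.set s (st.set s ∪ {st.idx i})⟩
  | erase (s i st) : Runs M (.erase s i) st 1
      ⟨st.idx, Function.update st.set s (st.set s \ {st.idx i})⟩
  | seq {c d st k st' l st''} : Runs M c st k st' → Runs M d st' l st'' →
      Runs M (.seq c d) st (k + l) st''
  | cond_true {t c d st k st'} : t.Holds M st → Runs M c st k st' →
      Runs M (.cond t c d) st (k + 1) st'
  | cond_false {t c d st k st'} : ¬ t.Holds M st → Runs M d st k st' →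
      Runs M (.cond t c d) st (k + 1) st'
  | loop_true {t c st k st' l st''} : t.Holds M st → Runs M c st k st' →
      Runs M (.loop t c) st' l st'' → Runs M (.loop t c) st (k + l + 1) st''
  | loop_false {t c st} : ¬ t.Holds M st → Runs M (.loop t c) st 1 st

/-- The initial state on input `X`: set register `0` holds `X`, all other set registers are
empty and all index registers are zero. -/
def State.init {n : ℕ} (X : Set (Fin n)) : State where
  idx := fun _ => 0
  set := fun s => if s = 0 then {v | ∃ x ∈ X, (x : ℕ) = v} else ∅

/-- The output of a final state: the set of events in set register `1`. -/
def State.output (n : ℕ) (st : State) : Set (Fin n) := {x | (x : ℕ) ∈ st.set 1}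

end CESProg

namespace Stream'.Seq

variable {E : Type*}

/-- If `s` has an `i`-th entry, then its prefix of length `i` really has length `i`. -/
theorem length_take_of_get? {s : Seq E} {i : ℕ} {e : E} (h : s.get? i = some e) :
    (s.take i).length = i := by
  apply le_antisymm length_take_le
  by_contra hlt
  have h1 : (s.take i)[(s.take i).length]? = none := by simp
  rw [getElem?_take, if_pos (by omega)] at h1
  rw [s.le_stable (by omega) h1] at h
  cases h

theorem take_succ_of_get? {s : Seq E} {i : ℕ} {e : E} (h : s.get? i = some e) :
    s.take (i + 1) = s.take i ++ [e] := by
  apply List.ext_getElem?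
  intro k
  rw [List.getElem?_append, length_take_of_get? h, getElem?_take, getElem?_take]
  rcases lt_trichotomy k i with hk | rfl | hk
  · rw [if_pos (by omega), if_pos hk, if_pos hk]
  · simp [h]
  · rw [if_neg (by omega), if_neg (by omega)]
    symm
    simp
    omega

theorem take_prefix_take (s : Seq E) {i j : ℕ} (h : i ≤ j) : s.take i <+: s.take j := by
  have : s.take i = (s.take j).take i := by
    apply List.ext_getElem?
    intro k
    rw [List.getElem?_take, getElem?_take, getElem?_take]
    split_ifs <;> first | rfl | omega
  rw [this]
  exact List.take_prefix _ _

theorem take_take (s : Seq E) {i j : ℕ} (h : i ≤ j) : (s.take j : Seq E).take i = s.take i := by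
  apply List.ext_getElem?
  intro k
  rw [getElem?_take, ofList_get?, getElem?_take, getElem?_take]
  split_ifs <;> first | rfl | omega

theorem mem_take_iff {s : Seq E} {i : ℕ} {e : E} :
    e ∈ s.take i ↔ ∃ j, j < i ∧ s.get? j = some e := by
  rw [List.mem_iff_getElem?]
  refine exists_congr fun j => ?_
  rw [getElem?_take]
  split_ifs with h <;> simp [h]

/-- The limit of an increasing chain of lists. -/
theorem exists_limit (L : ℕ → List E) (hL : ∀ n m, n ≤ m → L n <+: L m) :
    ∃ s : Seq E, ∀ i e, s.get? i = some e ↔ ∃ n, (L n)[i]? = some e := by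
  classical
  have key : ∀ i n m e, (L n)[i]? = some e → i < (L m).length → (L m)[i]? = some e := by
    intro i n m e h1 h2
    have h3 : i < (L n).length := by
      by_contra h
      rw [List.getElem?_eq_none (by omega)] at h1
      cases h1
    rcases le_total n m with h | h
    · obtain ⟨t, ht⟩ := hL _ _ h
      rw [← h1, ← ht, List.getElem?_append_left h3]
    · obtain ⟨t, ht⟩ := hL _ _ h
      rw [← h1, ← ht, List.getElem?_append_left h2]
  refine ⟨⟨fun i => if h : ∃ n, i < (L n).length then (L h.choose)[i]? else none, ?_⟩, ?_⟩
  · intro i hi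
    have h1 : ¬ ∃ n, i < (L n).length := by
      intro h
      have hi' : (if h : ∃ n, i < (L n).length then (L h.choose)[i]? else none) = none := hi
      rw [dif_pos h, List.getElem?_eq_none_iff] at hi'
      have := h.choose_spec
      omega
    have h2 : ¬ ∃ n, i + 1 < (L n).length := fun ⟨n, hn⟩ => h1 ⟨n, by omega⟩
    exact dif_neg h2
  · intro i e
    change (if h : ∃ n, i < (L n).length then (L h.choose)[i]? else none) = some e ↔ _
    constructor
    · intro h
      split_ifs at h with h1
      exact ⟨_, h⟩
    · rintro ⟨n, hn⟩
      have h1 : ∃ n, i < (L n).length := by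
        refine ⟨n, ?_⟩
        by_contra h
        rw [List.getElem?_eq_none (by omega)] at hn
        cases hn
      rw [dif_pos h1]
      exact key i n _ e hn h1.choose_spec

/-- One event is appended at each stage at which the scheduled event is admissible. -/
noncomputable def run (sched : ℕ → Option E) (adm : List E → E → Prop) (τ : List E) :
    ℕ → List E
  | 0 => τ
  | n + 1 => open Classical in
      match sched n with
      | some e => if adm (run sched adm τ n) e then run sched adm τ n ++ [e]
          else run sched adm τ n
      | none => run sched adm τ n

theorem run_succ (sched : ℕ → Option E) (adm : List E → E → Prop) (τ : List E) (n : ℕ) :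
    run sched adm τ (n + 1) = run sched adm τ n ∨
    ∃ e, adm (run sched adm τ n) e ∧ run sched adm τ (n + 1) = run sched adm τ n ++ [e] := by
  classical
  rw [run]
  rcases sched n with _ | e
  · exact Or.inl rfl
  · by_cases h : adm (run sched adm τ n) e
    · right; exact ⟨e, h, by simp [h]⟩
    · left; simp [h]

theorem run_succ_of_adm {sched : ℕ → Option E} {adm : List E → E → Prop} {τ : List E} {n : ℕ}
    {e : E} (h : sched n = some e) (ha : adm (run sched adm τ n) e) :
    run sched adm τ (n + 1) = run sched adm τ n ++ [e] := by
  rw [run]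
  simp [h, ha]

theorem run_prefix (sched : ℕ → Option E) (adm : List E → E → Prop) (τ : List E) (n m : ℕ)
    (h : n ≤ m) : run sched adm τ n <+: run sched adm τ m := by
  induction m, h using Nat.le_induction with
  | base => exact List.prefix_rfl
  | succ m _ ih =>
    rcases run_succ sched adm τ m with h | ⟨e, _, h⟩
    · rwa [h]
    · rw [h]; exact ih.trans (List.prefix_append _ _)

theorem exists_schedule (E : Type*) [Countable E] :
    ∃ sched : ℕ → Option E, ∀ e n, ∃ m, n ≤ m ∧ sched m = some e := by
  obtain ⟨_⟩ := nonempty_encodable E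
  refine ⟨fun n => Encodable.decode (Nat.unpair n).2, fun e n => ?_⟩
  exact ⟨Nat.pair n (Encodable.encode e), Nat.left_le_pair _ _, by simp⟩

/-- Round-robin scheduling: every list extends to a sequence in which all further entries are
admissible when they occur, and no entry is perpetually admissible. -/
theorem exists_fair_run [Countable E] (adm : List E → E → Prop)
    (hadm : ∀ τ e, adm τ e → e ∉ τ) (τ : List E) :
    ∃ s : Seq E, s.take τ.length = τ ∧
      (∀ i e, τ.length ≤ i → s.get? i = some e → adm (s.take i) e) ∧
      ∀ e i, ∃ j, i ≤ j ∧ ¬ adm (s.take j) e := by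
  obtain ⟨sched, hsched⟩ := exists_schedule E
  set L := run sched adm τ with hL
  have hpre := run_prefix sched adm τ
  rw [← hL] at hpre
  obtain ⟨s, hs⟩ := exists_limit L hpre
  have htake : ∀ n, s.take (L n).length = L n := by
    intro n
    apply List.ext_getElem?
    intro k
    rw [getElem?_take]
    split_ifs with hk
    · rw [List.getElem?_eq_getElem hk, hs]
      exact ⟨n, List.getElem?_eq_getElem hk⟩
    · rw [List.getElem?_eq_none (by omega)]
  refine ⟨s, htake 0, ?_, ?_⟩
  · intro i e hi he
    have hex : ∃ n, i < (L n).length := by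
      obtain ⟨n, hn⟩ := (hs i e).1 he
      refine ⟨n, ?_⟩
      by_contra h
      rw [List.getElem?_eq_none (by omega)] at hn
      cases hn
    classical
    obtain ⟨n, hn, hmin⟩ : ∃ n, i < (L n).length ∧ ∀ m < n, (L m).length ≤ i :=
      ⟨Nat.find hex, Nat.find_spec hex, fun m hm => by simpa using Nat.find_min hex hm⟩
    cases n with
    | zero => exact absurd hn (by simpa [hL, run] using hi)
    | succ m =>
      have hm := hmin m (by omega)
      rcases run_succ sched adm τ m with h | ⟨f, hf, h⟩
      · rw [← hL] at h; rw [h] at hn; omega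
      · rw [← hL] at h hf
        rw [h] at hn
        have hlen : (L m).length = i := by simp at hn; omega
        have h2 : s.get? i = some f := (hs i f).2 ⟨m + 1, by rw [h, ← hlen]; simp⟩
        rw [h2] at he
        cases he
        rw [← hlen, htake]
        exact hf
  · intro e i
    by_contra hcon
    push Not at hcon
    by_cases hb : ∃ N, i ≤ (L N).length
    · obtain ⟨N, hN⟩ := hb
      obtain ⟨n, hn, hse⟩ := hsched e N
      have h1 : i ≤ (L n).length := hN.trans (hpre _ _ hn).length_le
      have h2 := hcon _ h1
      rw [htake] at h2
      have h3 := run_succ_of_adm hse h2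
      rw [← hL] at h3
      have h4 := hcon (L (n + 1)).length (h1.trans (hpre _ _ (Nat.le_succ n)).length_le)
      rw [htake] at h4
      exact hadm _ _ h4 (by rw [h3]; simp)
    · push Not at hb
      obtain ⟨N, hN⟩ : ∃ N, ∀ n, (L n).length ≤ (L N).length := by
        have hfin : (Set.range fun n => (L n).length).Finite :=
          (Set.finite_lt_nat i).subset (by rintro _ ⟨n, rfl⟩; exact hb n)
        obtain ⟨_, ⟨N, rfl⟩, hN⟩ := Set.exists_max_image _ id hfin ⟨_, 0, rfl⟩
        exact ⟨N, fun n => hN _ ⟨n, rfl⟩⟩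
      have hnone : s.get? (L N).length = none := by
        by_contra h
        obtain ⟨f, hf⟩ := Option.ne_none_iff_exists'.1 h
        obtain ⟨n, hn⟩ := (hs _ _).1 hf
        rw [List.getElem?_eq_none (hN n)] at hn
        cases hn
      have heq : ∀ n, N ≤ n → L n = s.take i := by
        intro n hn
        have hpi : L N <+: s.take i := htake N ▸ take_prefix_take s (hb N).le
        rw [← (hpre N n hn).eq_of_length (le_antisymm (hpre _ _ hn).length_le (hN n))]
        refine hpi.eq_of_length (le_antisymm hpi.length_le ?_)
        have h1 : (s.take i)[(L N).length]? = none := by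
          rw [getElem?_take]; split_ifs <;> simp [hnone]
        exact List.getElem?_eq_none_iff.1 h1
      obtain ⟨n, hn, hse⟩ := hsched e N
      have h2 := hcon i le_rfl
      rw [← heq n hn] at h2
      have h3 := run_succ_of_adm hse h2
      rw [← hL] at h3
      have h4 := congrArg List.length h3
      rw [heq _ (hn.trans (Nat.le_succ n)), ← heq _ hn] at h4
      simp at h4

theorem get?_append_of_lt {σ : List E} {η : Seq E} {i : ℕ} (h : i < σ.length) :
    ((σ : Seq E).append η).get? i = σ[i]? := by
  induction σ generalizing i with
  | nil => simp at h
  | cons a σ ih =>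
    rw [ofList_cons, cons_append]
    cases i with
    | zero => simp
    | succ i => simpa using ih (by simpa using h)

theorem get?_append_add (σ : List E) (η : Seq E) (i : ℕ) :
    ((σ : Seq E).append η).get? (σ.length + i) = η.get? i := by
  induction σ with
  | nil => simp
  | cons a σ ih =>
    rw [ofList_cons, cons_append, List.length_cons, show σ.length + 1 + i = σ.length + i + 1 by omega,
      get?_cons_succ, ih]

theorem append_drop_of_take {σ : List E} {s : Seq E} (h : s.take σ.length = σ) :
    (σ : Seq E).append (s.drop σ.length) = s := by
  apply Seq.ext
  intro k
  rcases lt_or_ge k σ.length with hk | hk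
  · rw [get?_append_of_lt hk]
    conv_lhs => rw [← h]
    rw [getElem?_take, if_pos hk]
  · obtain ⟨j, rfl⟩ := Nat.exists_eq_add_of_le hk
    rw [get?_append_add, drop_get?]

end Stream'.Seq

namespace CES

open Stream'.Seq

variable {E A : Type*} {M : CES E}

/-- The least set that contains `X` and the events circularly enabled by `W`, and that is closed
under enabling. -/
inductive Closure (M : CES E) (W X : Set E) : E → Prop
  | base {e} : e ∈ X → Closure M W X e
  | circ {e} : M.CircEnables W e → Closure M W X e
  | enab {e} (Y : Finset E) : (∀ y ∈ Y, Closure M W X y) → M.enab Y e → Closure M W X e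

/-- The set of events derivable from the past `X` and the circular assumptions `W`. -/
def closure (M : CES E) (W X : Set E) : Set E := {e | M.Closure W X e}

/-- The largest set of events that can be derived from the past `X` assuming the set itself. -/
def full (M : CES E) (X : Set E) : Set E := {e | ∃ W, W ⊆ M.closure W X ∧ e ∈ W}

theorem ConflictFree.cf (hM : M.ConflictFree) (X : Set E) : M.CF X := fun a _ b _ => hM a b

theorem Enables.mono (hM : M.ConflictFree) {X Y : Set E} {e : E} (h : M.Enables X e)
    (hXY : X ⊆ Y) : M.Enables Y e := by
  obtain ⟨_, Z, hZ, he⟩ := h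
  exact ⟨hM.cf _, Z, hZ.trans hXY, he⟩

theorem CircEnables.mono (hM : M.ConflictFree) {X Y : Set E} {e : E} (h : M.CircEnables X e)
    (hXY : X ⊆ Y) : M.CircEnables Y e := by
  obtain ⟨_, Z, hZ, he⟩ := h
  exact ⟨hM.cf _, Z, hZ.trans hXY, he⟩

theorem subset_closure (M : CES E) (W X : Set E) : X ⊆ M.closure W X := fun _ h => .base h

theorem closure_subset_closure (hM : M.ConflictFree) {W W' X X' : Set E} (hW : W ⊆ W')
    (hX : X ⊆ M.closure W' X') : M.closure W X ⊆ M.closure W' X' := by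
  intro e he
  induction he with
  | base h => exact hX h
  | circ h => exact .circ (h.mono hM hW)
  | enab Y _ h ih => exact .enab Y ih h

theorem closure_of_enables {W X Z : Set E} {e : E} (h : M.Enables Z e)
    (hZ : Z ⊆ M.closure W X) : e ∈ M.closure W X := by
  obtain ⟨_, Y, hY, he⟩ := h
  exact .enab Y (fun y hy => hZ (hY hy)) he

theorem subset_full {W X : Set E} (h : W ⊆ M.closure W X) : W ⊆ M.full X :=
  fun _ he => ⟨W, h, he⟩

theorem full_subset_closure (hM : M.ConflictFree) (X : Set E) :
    M.full X ⊆ M.closure (M.full X) X := by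
  rintro e ⟨W, hW, he⟩
  exact closure_subset_closure hM (subset_full hW) (subset_closure M _ _) (hW he)

theorem closure_full (hM : M.ConflictFree) (X : Set E) :
    M.closure (M.full X) X = M.full X := by
  refine subset_antisymm (subset_full ?_) (full_subset_closure hM X)
  exact closure_subset_closure hM (full_subset_closure hM X) (subset_closure M _ _)

theorem self_subset_full (hM : M.ConflictFree) (X : Set E) : X ⊆ M.full X := by
  rw [← closure_full hM]
  exact subset_closure M _ _

theorem full_mono (hM : M.ConflictFree) {X Y : Set E} (h : X ⊆ Y) : M.full X ⊆ M.full Y :=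
  subset_full ((full_subset_closure hM X).trans
    (closure_subset_closure hM subset_rfl (h.trans (subset_closure M _ _))))

theorem mem_events_coe {l : List E} {e : E} : e ∈ events (l : Stream'.Seq E) ↔ e ∈ l := by
  simp [events, List.mem_iff_getElem?]

theorem events_take_mono (s : Stream'.Seq E) {i j : ℕ} (h : i ≤ j) :
    events (s.take i : Stream'.Seq E) ⊆ events (s.take j : Stream'.Seq E) := by
  intro e
  simp only [mem_events_coe]
  exact fun he => (take_prefix_take s h).subset he

theorem events_take_subset (s : Stream'.Seq E) (i : ℕ) :
    events (s.take i : Stream'.Seq E) ⊆ events s := by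
  intro e he
  rw [mem_events_coe, mem_take_iff] at he
  obtain ⟨j, _, hj⟩ := he
  exact ⟨j, hj⟩

theorem exists_subset_take {s : Stream'.Seq E} (Y : Finset E) (h : (Y : Set E) ⊆ events s) :
    ∃ i, (Y : Set E) ⊆ events (s.take i : Stream'.Seq E) := by
  classical
  induction Y using Finset.induction_on with
  | empty => exact ⟨0, by simp⟩
  | insert a Y _ ih =>
    rw [Finset.coe_insert, Set.insert_subset_iff] at h
    obtain ⟨i, hi⟩ := ih h.2
    obtain ⟨j, hj⟩ := h.1
    refine ⟨max i (j + 1), ?_⟩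
    rw [Finset.coe_insert, Set.insert_subset_iff]
    refine ⟨?_, hi.trans (events_take_mono s (le_max_left _ _))⟩
    rw [mem_events_coe, mem_take_iff]
    exact ⟨j, by omega, hj⟩

theorem exists_circEnables_take (hM : M.ConflictFree) {s : Stream'.Seq E} {e : E}
    (h : M.CircEnables (events s) e) :
    ∃ i, M.CircEnables (events (s.take i : Stream'.Seq E)) e := by
  obtain ⟨_, Y, hY, he⟩ := h
  obtain ⟨i, hi⟩ := exists_subset_take Y hY
  exact ⟨i, hM.cf _, Y, hi, he⟩

theorem isPlay_coe (hM : M.ConflictFree) {l : List E} :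
    M.IsPlay (l : Stream'.Seq E) ↔ l.Nodup := by
  constructor
  · rintro ⟨h, -⟩
    rw [List.nodup_iff_injective_getElem]
    rintro ⟨i, hi⟩ ⟨j, hj⟩ hij
    ext
    exact h i j l[i] (by simp [hi]) (by simpa [hj] using hij.symm)
  · intro h
    refine ⟨fun i j e hi hj => ?_, hM.cf _⟩
    rw [ofList_get?] at hi hj
    have hi' : i < l.length := (List.getElem?_eq_some_iff.1 hi).1
    exact (List.getElem?_inj hi' h).1 (hi.trans hj.symm)

theorem IsPlay.take (hM : M.ConflictFree) {s : Stream'.Seq E} (h : M.IsPlay s) (i : ℕ) :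
    M.IsPlay (s.take i : Stream'.Seq E) := by
  refine ⟨fun j k e hj hk => ?_, hM.cf _⟩
  rw [ofList_get?, getElem?_take] at hj hk
  split_ifs at hj hk
  exact h.1 j k e hj hk

theorem isPlay_append_singleton (hM : M.ConflictFree) {l : List E} {e : E} :
    M.IsPlay ((l ++ [e] : List E) : Stream'.Seq E) ↔
      M.IsPlay (l : Stream'.Seq E) ∧ e ∉ l := by
  rw [isPlay_coe hM, isPlay_coe hM, ← List.concat_eq_append, List.nodup_concat, and_comm]

/-- A sequence that extends a play by events that are new when they occur is a play. -/
theorem isPlay_of_take (hM : M.ConflictFree) {s : Stream'.Seq E} {l : List E}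
    (hl : M.IsPlay (l : Stream'.Seq E)) (hs : s.take l.length = l)
    (h : ∀ i e, l.length ≤ i → s.get? i = some e → e ∉ s.take i) : M.IsPlay s := by
  have key : ∀ i j e, i < j → s.get? i = some e → s.get? j = some e → False := by
    intro i j e hij hi hj
    rcases lt_or_ge j l.length with hlt | hge
    · refine hij.ne (hl.1 i j e ?_ ?_)
      · rw [ofList_get?, ← hs, getElem?_take, if_pos (by omega), hi]
      · rw [ofList_get?, ← hs, getElem?_take, if_pos (by omega), hj]
    · exact h j e hge hj (mem_take_iff.2 ⟨i, hij, hi⟩)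
  refine ⟨fun i j e hi hj => ?_, hM.cf _⟩
  rcases lt_trichotomy i j with hij | hij | hij
  · exact (key i j e hij hi hj).elim
  · exact hij
  · exact (key j i e hij hj hi).elim

theorem mem_credits_take {s : Stream'.Seq E} {k : ℕ} {e : E} :
    e ∈ M.credits (s.take k : Stream'.Seq E) ↔ ∃ i, i < k ∧ s.get? i = some e ∧
      ¬ M.Enables (events (s.take i : Stream'.Seq E)) e ∧
      ¬ M.CircEnables (events (s.take k : Stream'.Seq E)) e := by
  refine exists_congr fun i => ?_
  rw [ofList_get?, getElem?_take]
  split_ifs with h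
  · rw [take_take s h.le]
    simp [h]
  · simp [h]

theorem credits_coe_subset (l : List E) :
    M.credits (l : Stream'.Seq E) ⊆ events (l : Stream'.Seq E) :=
  fun _ ⟨i, h, _⟩ => ⟨i, h⟩

theorem closure_subset_events {s : Stream'.Seq E} {W X : Set E} (hM : M.ConflictFree)
    (hX : X ⊆ events s) (hW : ∀ e, M.CircEnables W e → e ∈ events s)
    (hen : ∀ i e, M.Enables (events (s.take i : Stream'.Seq E)) e → e ∈ events s) :
    M.closure W X ⊆ events s := by
  intro e he
  induction he with
  | base h => exact hX h
  | circ h => exact hW _ h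
  | enab Y _ h ih =>
    obtain ⟨i, hi⟩ := exists_subset_take Y ih
    exact hen i _ ⟨hM.cf _, Y, hi, h⟩

/-- Together with its past, the reachable events form the set `full`. -/
theorem union_reach [Countable E] (hM : M.ConflictFree) {l : List E}
    (hl : M.IsPlay (l : Stream'.Seq E)) :
    events (l : Stream'.Seq E) ∪ M.reach (events (l : Stream'.Seq E)) =
      M.full (events (l : Stream'.Seq E)) := by
  set X := events (l : Stream'.Seq E) with hX
  apply subset_antisymm
  · refine Set.union_subset (self_subset_full hM X) ?_
    rintro e ⟨_, τ, η, _, _, he, hcr⟩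
    set s := (τ : Stream'.Seq E).append η with hs
    have key : ∀ i f, s.get? i = some f → f ∈ M.closure (events s) X := by
      intro i
      induction i using Nat.strong_induction_on with
      | _ i ih =>
        intro f hf
        by_cases h1 : M.CircEnables (events s) f
        · exact .circ h1
        by_cases h2 : M.Enables (events (s.take i : Stream'.Seq E)) f
        · refine closure_of_enables h2 fun g hg => ?_
          rw [mem_events_coe, mem_take_iff] at hg
          obtain ⟨j, hj, hg⟩ := hg
          exact ih j hj g hg
        · exact .base (hcr ⟨i, hf, h2, h1⟩)
    obtain ⟨i, hi⟩ := he
    refine subset_full (W := events s) ?_ ⟨τ.length + i, ?_⟩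
    · rintro f ⟨j, hj⟩
      exact key j f hj
    · rw [hs, get?_append_add, hi]
  · obtain ⟨s, hsl, hadm, hfair⟩ := exists_fair_run (fun τ f => f ∉ τ ∧
      (M.Enables (events (τ : Stream'.Seq E)) f ∨ M.CircEnables (M.full X) f))
      (fun _ _ h => h.1) l
    have hXs : X ⊆ events s := by
      rw [hX, ← hsl]
      exact events_take_subset s _
    have hfull : M.full X ⊆ events s := by
      rw [← closure_full hM]
      refine closure_subset_events hM hXs ?_ ?_
      · intro f hf
        obtain ⟨j, _, hj⟩ := hfair f 0
        by_contra hfs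
        exact hj ⟨fun h => hfs (events_take_subset s j (mem_events_coe.2 h)), Or.inr hf⟩
      · intro i f hf
        obtain ⟨j, hij, hj⟩ := hfair f i
        by_contra hfs
        exact hj ⟨fun h => hfs (events_take_subset s j (mem_events_coe.2 h)),
          Or.inl (hf.mono hM (events_take_mono s hij))⟩
    intro e he
    by_cases heX : e ∈ X
    · exact Or.inl heX
    refine Or.inr ⟨heX, l, s.drop l.length, ?_, rfl, ?_, ?_⟩
    · rw [append_drop_of_take hsl]
      exact isPlay_of_take hM hl hsl fun i f hi hf => (hadm i f hi hf).1
    · obtain ⟨i, hi⟩ := hfull he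
      have hil : l.length ≤ i := by
        by_contra hlt
        refine heX (mem_events_coe.2 ?_)
        rw [← hsl]
        exact mem_take_iff.2 ⟨i, by omega, hi⟩
      obtain ⟨j, rfl⟩ := Nat.exists_eq_add_of_le hil
      exact ⟨j, by rw [drop_get?, hi]⟩
    · rw [append_drop_of_take hsl]
      rintro f ⟨i, hi, h1, h2⟩
      rcases lt_or_ge i l.length with hlt | hge
      · rw [hX, mem_events_coe, ← hsl]
        exact mem_take_iff.2 ⟨i, hlt, hi⟩
      · rcases (hadm i f hge hi).2 with h | h
        · exact absurd h h1
        · exact absurd (h.mono hM hfull) h2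

theorem mem_criterion [Countable E] (hM : M.ConflictFree) {l : List E}
    (hl : M.IsPlay (l : Stream'.Seq E)) {e : E} :
    e ∈ M.criterion (events (l : Stream'.Seq E)) ↔ e ∉ l ∧
      (M.Enables (events (l : Stream'.Seq E)) e ∨
        M.CircEnables (M.full (events (l : Stream'.Seq E))) e) := by
  rw [criterion, Set.mem_ofPred_eq, union_reach hM hl, mem_events_coe]

/-- The events of `a` that satisfy the criterion, once the past `σ` has been played, and before
that the events of `σ`. -/
def criterionStrategy (M : CES E) (π : E → A) (a : A) (σ τ : List E) : Set E :=
  {f | π f = a ∧ ((σ <+: τ ∧ f ∈ M.criterion (events (τ : Stream'.Seq E))) ∨ τ ++ [f] <+: σ)}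

theorem isStrategy_criterionStrategy [Countable E] (hM : M.ConflictFree) (π : E → A) (a : A)
    {σ : List E} (hσ : M.IsPlay (σ : Stream'.Seq E)) :
    M.IsStrategy π a (M.criterionStrategy π a σ) := by
  rintro τ hτ f ⟨hf, ⟨_, h⟩ | h⟩
  · exact ⟨hf, (isPlay_append_singleton hM).2 ⟨hτ, ((mem_criterion hM hτ).1 h).1⟩⟩
  · exact ⟨hf, (isPlay_coe hM).2 (((isPlay_coe hM).1 hσ).sublist h.sublist)⟩

theorem take_coe_prefix (l : List E) (i : ℕ) : (l : Stream'.Seq E).take i <+: l := by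
  have : (l : Stream'.Seq E).take i = l.take i := by
    apply List.ext_getElem?
    intro k
    rw [getElem?_take, ofList_get?, List.getElem?_take]
  rw [this]
  exact List.take_prefix _ _

theorem conforms_criterionStrategy (M : CES E) (π : E → A) (a : A) (σ : List E) :
    Conforms π a (M.criterionStrategy π a σ) (σ : Stream'.Seq E) := by
  intro i f hf hfa
  refine ⟨hfa, Or.inr ?_⟩
  rw [← take_succ_of_get? hf]
  exact take_coe_prefix σ _

theorem criterion_mono_take [Countable E] (hM : M.ConflictFree) {s : Stream'.Seq E}
    (hs : M.IsPlay s) {i j : ℕ} (h : i ≤ j) {f : E}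
    (hf : f ∈ M.criterion (events (s.take i : Stream'.Seq E))) :
    f ∈ s.take j ∨ f ∈ M.criterion (events (s.take j : Stream'.Seq E)) := by
  rw [mem_criterion hM (hs.take hM i)] at hf
  rw [mem_criterion hM (hs.take hM j)]
  by_cases hfj : f ∈ s.take j
  · exact Or.inl hfj
  · exact Or.inr ⟨hfj, hf.2.imp (fun h' => h'.mono hM (events_take_mono s h))
      (fun h' => h'.mono hM (full_mono hM (events_take_mono s h)))⟩

/-- In a play in which no event perpetually satisfies the criterion, all events occur that
can be derived from a past. -/
theorem full_take_subset_events [Countable E] (hM : M.ConflictFree) {s : Stream'.Seq E}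
    (hs : M.IsPlay s)
    (h : ∀ f i, ∃ j, i ≤ j ∧ f ∉ M.criterion (events (s.take j : Stream'.Seq E))) (i : ℕ) :
    M.full (events (s.take i : Stream'.Seq E)) ⊆ events s := by
  have hcrit : ∀ j f, f ∉ s.take j ∧ (M.Enables (events (s.take j : Stream'.Seq E)) f ∨
      M.CircEnables (M.full (events (s.take j : Stream'.Seq E))) f) → f ∈ events s := by
    intro j f hf
    rw [← mem_criterion hM (hs.take hM j)] at hf
    obtain ⟨k, hjk, hk⟩ := h f j
    exact events_take_subset s k
      (mem_events_coe.2 ((criterion_mono_take hM hs hjk hf).resolve_right hk))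
  have hcrit' : ∀ j f, M.Enables (events (s.take j : Stream'.Seq E)) f ∨
      M.CircEnables (M.full (events (s.take j : Stream'.Seq E))) f → f ∈ events s := by
    intro j f hf
    by_cases hfj : f ∈ s.take j
    · exact events_take_subset s j (mem_events_coe.2 hfj)
    · exact hcrit j f ⟨hfj, hf⟩
  rw [← closure_full hM]
  exact closure_subset_events hM (events_take_subset s i) (fun f hf => hcrit' i f (Or.inr hf))
    (fun j f hf => hcrit' j f (Or.inl hf))

theorem prudent_of_mem_criterion [Countable E] (hM : M.ConflictFree)
    (hC : {e : E | ∃ Z : Finset E, M.circ Z e}.Finite) (π : E → A) {σ : List E}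
    (hσ : M.IsPlay (σ : Stream'.Seq E)) {e : E}
    (he : e ∈ M.criterion (events (σ : Stream'.Seq E))) : M.Prudent π σ e := by
  set P : List E → E → Prop := fun τ f =>
    M.IsPlay (τ : Stream'.Seq E) ∧ f ∈ M.criterion (events (τ : Stream'.Seq E)) with hP
  suffices h : P ≤ M.prudenceStep π P from OrderHom.le_gfp _ h σ e ⟨hσ, he⟩
  clear! σ e
  rintro σ e ⟨hσ, he⟩
  refine ⟨hσ, M.criterionStrategy π (π e) σ, ⟨isStrategy_criterionStrategy hM π _ hσ,
    conforms_criterionStrategy M π _ σ, ?_⟩, rfl, Or.inl ⟨List.prefix_rfl, he⟩⟩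
  intro s hs hsσ hconf hfair hinn
  have hnot : ∀ f i, ∃ j, i ≤ j ∧ f ∉ M.criterion (events (s.take j : Stream'.Seq E)) := by
    intro f i
    by_contra hcon
    push Not at hcon
    by_cases hf : π f = π e
    · obtain ⟨h, hih, hh⟩ := hfair f (max i σ.length) fun j hj => ⟨hf, Or.inl
        ⟨hsσ ▸ take_prefix_take s (by omega), hcon j (by omega)⟩⟩
      exact ((mem_criterion hM (hs.take hM _)).1 (hcon (h + 1) (by omega))).1
        (mem_take_iff.2 ⟨h, by omega, hh⟩)
    · obtain ⟨j, hj, hn⟩ := hinn (π f) hf f rfl i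
      exact hn ⟨hs.take hM j, hcon j hj⟩
  have hfull := full_take_subset_events hM hs hnot
  obtain ⟨K, hK⟩ : ∃ K, ∀ f, M.CircEnables (events s) f →
      M.CircEnables (events (s.take K : Stream'.Seq E)) f := by
    have hfin : {f | M.CircEnables (events s) f}.Finite :=
      hC.subset fun f ⟨_, Y, _, hY⟩ => ⟨Y, hY⟩
    choose! g hg using fun f (hf : M.CircEnables (events s) f) => exists_circEnables_take hM hf
    obtain ⟨K, hK⟩ := (hfin.image g).bddAbove
    exact ⟨K, fun f hf => (hg f hf).mono hM (events_take_mono s (hK ⟨f, hf, rfl⟩))⟩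
  refine ⟨max K (σ.length + 1), by omega, ?_⟩
  rintro f ⟨hf, hfa⟩
  obtain ⟨i, hi, hsi, hen, hcirc⟩ := mem_credits_take.1 hf
  rcases lt_or_ge i σ.length with hlt | hge
  · rw [← hsσ, mem_credits_take]
    exact ⟨i, hlt, hsi, hen,
      fun h => hcirc (h.mono hM (events_take_mono s (by omega)))⟩
  · exfalso
    rcases hconf i f hsi hfa with ⟨_, ⟨_, h⟩ | h⟩
    · rcases ((mem_criterion hM (hs.take hM i)).1 h).2 with h | h
      · exact hen h
      · exact hcirc ((hK f (h.mono hM (hfull i))).mono hM (events_take_mono s (by omega)))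
    · have := h.length_le
      rw [List.length_append, length_take_of_get? hsi] at this
      simp at this
      omega

/-- A prudent event can be played so that its debt, if any, is honoured in a finite play that
extends the past by the event, and in which all other participants play prudent events. -/
theorem Prudent.exists_play [Countable E] (hM : M.ConflictFree) {π : E → A} {σ : List E} {e : E}
    (h : M.Prudent π σ e) : ∃ (s : Stream'.Seq E) (k : ℕ), M.IsPlay s ∧ s.take σ.length = σ ∧
      s.get? σ.length = some e ∧ σ.length < k ∧
      M.credits (s.take k : Stream'.Seq E) ∩ {f | π f = π e} ⊆ M.credits (σ : Stream'.Seq E) ∧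
      ∀ i f, σ.length < i → s.get? i = some f → π f ≠ π e → M.Prudent π (s.take i) f := by
  obtain ⟨hσ, S, ⟨hS, hconf, hprud⟩, heS⟩ := (M.prudent_iff π σ e).1 h
  obtain ⟨s, hs, hadm, hfair⟩ := exists_fair_run (fun τ f => f ∉ τ ∧
    (π f = π e → f ∈ S τ) ∧ (π f ≠ π e → M.Prudent π τ f)) (fun _ _ h => h.1) (σ ++ [e])
  have hplay : M.IsPlay s := isPlay_of_take hM (hS σ hσ e heS).2 hs
    fun i f hi hf => (hadm i f hi hf).1
  simp only [List.length_append, List.length_singleton] at hs hadm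
  have hsσ : s.take σ.length = σ := by
    apply List.ext_getElem?
    intro j
    have h1 := congrArg (·[j]?) hs
    simp only [getElem?_take] at h1 ⊢
    split_ifs with hj
    · rw [if_pos (by omega), List.getElem?_append_left hj] at h1
      exact h1
    · rw [List.getElem?_eq_none (by omega)]
  have hse : s.get? σ.length = some e := by
    have h1 := congrArg (·[σ.length]?) hs
    simpa [getElem?_take] using h1
  suffices hs' : Conforms π (π e) S s ∧ Fair S s ∧
      ∀ b, b ≠ π e → InnocentWrt (M.Prudent π) π b s by
    obtain ⟨k, hk, hcr⟩ := hprud s hplay hsσ hs'.1 hs'.2.1 hs'.2.2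
    exact ⟨s, k, hplay, hsσ, hse, hk, hcr, fun i f hi hf => (hadm i f hi hf).2.2⟩
  refine ⟨?_, ?_, ?_⟩
  · intro i f hf hfe
    rcases lt_trichotomy i σ.length with hi | rfl | hi
    · rw [← hsσ] at hconf
      have := hconf i f (by rw [ofList_get?, getElem?_take, if_pos hi, hf]) hfe
      rwa [take_take s hi.le] at this
    · rw [hse] at hf
      cases hf
      rwa [hsσ]
    · exact (hadm i f hi hf).2.1 hfe
  · intro f i hf
    obtain ⟨j, hj, hn⟩ := hfair f i
    have h1 := hS _ (hplay.take hM j) f (hf j hj)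
    exact absurd ⟨((isPlay_append_singleton hM).1 h1.2).2, fun _ => hf j hj,
      fun h2 => absurd h1.1 h2⟩ hn
  · intro b hb f hfb i
    by_contra hcon
    push Not at hcon
    obtain ⟨j, hj, hn⟩ := hfair f i
    obtain ⟨h1, T, ⟨hT, _, _⟩, hfT⟩ := (M.prudent_iff π _ f).1 (hcon j hj)
    exact hn ⟨((isPlay_append_singleton hM).1 (hT _ h1 f hfT).2).2,
      fun h2 => absurd (hfb.symm.trans h2) hb, fun _ => hcon j hj⟩

theorem Prudent.isPlay_append (hM : M.ConflictFree) {π : E → A} {σ : List E} {e : E}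
    (h : M.Prudent π σ e) : M.IsPlay (σ : Stream'.Seq E) ∧ e ∉ σ := by
  obtain ⟨hσ, S, ⟨hS, _, _⟩, heS⟩ := (M.prudent_iff π σ e).1 h
  exact (isPlay_append_singleton hM).1 (hS σ hσ e heS).2

theorem Prudent.mem_criterion [Countable E] (hM : M.ConflictFree)
    (hC : {e : E | ∃ Z : Finset E, M.circ Z e}.Finite) {π : E → A} {σ : List E} {e : E}
    (h : M.Prudent π σ e) : e ∈ M.criterion (events (σ : Stream'.Seq E)) := by
  induction hm : ({e : E | ∃ Z : Finset E, M.circ Z e} \ {x | x ∈ σ}).ncard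
    using Nat.strong_induction_on generalizing σ e with
  | _ m ih =>
    subst hm
    obtain ⟨hσ, heσ⟩ := h.isPlay_append hM
    obtain ⟨s, k, hs, hsσ, hse, hk, hcr, hothers⟩ := h.exists_play hM
    rw [CES.mem_criterion hM hσ]
    refine ⟨heσ, ?_⟩
    by_cases hen : M.Enables (events (σ : Stream'.Seq E)) e
    · exact Or.inl hen
    right
    set Y := events (s.take k : Stream'.Seq E) with hY
    have hYe : M.CircEnables Y e := by
      by_contra hn
      refine heσ (mem_events_coe.1 (credits_coe_subset σ (hcr ⟨mem_credits_take.2 ?_, rfl⟩)))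
      exact ⟨σ.length, hk, hse, by rwa [hsσ], hn⟩
    have hIH : ∀ i f, σ.length < i → M.Prudent π (s.take i) f →
        f ∈ M.criterion (events (s.take i : Stream'.Seq E)) := by
      intro i f hi hf
      refine ih _ (Set.ncard_lt_ncard ?_ (hC.subset Set.sdiff_subset)) hf rfl
      have hei : e ∈ s.take i := mem_take_iff.2 ⟨_, hi, hse⟩
      refine (Set.ssubset_iff_of_subset ?_).2 ⟨e, ⟨?_, heσ⟩, fun h => h.2 hei⟩
      · exact Set.sdiff_subset_sdiff_right fun x hx =>
          (take_prefix_take s hi.le).subset (hsσ.symm ▸ hx)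
      · obtain ⟨_, Z, _, hZ⟩ := hYe
        exact ⟨Z, hZ⟩
    have hσi : ∀ i f, i < σ.length → s.get? i = some f → f ∈ events (σ : Stream'.Seq E) := by
      intro i f hi hf
      rw [mem_events_coe, ← hsσ]
      exact mem_take_iff.2 ⟨i, hi, hf⟩
    have key : ∀ i f, i < k → s.get? i = some f →
        f ∈ M.closure (M.full Y) (events (σ : Stream'.Seq E)) := by
      intro i
      induction i using Nat.strong_induction_on with
      | _ i ihi =>
        intro f hik hf
        by_cases h1 : M.Enables (events (s.take i : Stream'.Seq E)) f
        · refine closure_of_enables h1 fun g hg => ?_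
          rw [mem_events_coe, mem_take_iff] at hg
          obtain ⟨j, hj, hg⟩ := hg
          exact ihi j hj g (by omega) hg
        by_cases h2 : M.CircEnables Y f
        · exact .circ (h2.mono hM (self_subset_full hM Y))
        rcases lt_trichotomy i σ.length with hi | rfl | hi
        · exact .base (hσi i f hi hf)
        · rw [hse] at hf
          cases hf
          exact absurd hYe h2
        by_cases hfe : π f = π e
        · exact .base (credits_coe_subset σ (hcr ⟨mem_credits_take.2 ⟨i, hik, hf, h1, h2⟩, hfe⟩))
        · have h3 := hIH i f hi (hothers i f hi hf hfe)
          rw [CES.mem_criterion hM (hs.take hM i)] at h3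
          exact .circ ((h3.2.resolve_left h1).mono hM (full_mono hM (events_take_mono s hik.le)))
    have hYcl : Y ⊆ M.closure (M.full Y) (events (σ : Stream'.Seq E)) := by
      intro f hf
      rw [hY, mem_events_coe, mem_take_iff] at hf
      obtain ⟨i, hi, hf⟩ := hf
      exact key i f hi hf
    have hfull : M.full Y ⊆ M.full (events (σ : Stream'.Seq E)) :=
      subset_full ((full_subset_closure hM Y).trans (closure_subset_closure hM subset_rfl hYcl))
    exact hYe.mono hM ((self_subset_full hM Y).trans hfull)

end CES

namespace CESProg

variable {n : ℕ} {M : CES (Fin n)}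

/-- The sets of events in the set registers. -/
def State.ev (n : ℕ) (st : State) (s : ℕ) : Set (Fin n) := {x | (x : ℕ) ∈ st.set s}

/-- Total correctness with a bound on the number of steps. -/
def Triple (M : CES (Fin n)) (P : State → Prop) (c : Cmd) (T : ℕ) (Q : State → Prop) : Prop :=
  ∀ st, P st → ∃ k st', Runs M c st k st' ∧ k ≤ T ∧ Q st'

/-- The command never writes to index register `i`. -/
def Cmd.Fixes (i : ℕ) : Cmd → Prop
  | .skip => True
  | .zero j => i ≠ j
  | .succ j => i ≠ j
  | .insert _ _ => True
  | .erase _ _ => True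
  | .seq c d => c.Fixes i ∧ d.Fixes i
  | .cond _ c d => c.Fixes i ∧ d.Fixes i
  | .loop _ c => c.Fixes i

theorem Runs.idx_eq {c : Cmd} {st st' : State} {k i : ℕ} (h : Runs M c st k st')
    (hc : c.Fixes i) : st'.idx i = st.idx i := by
  induction h with
  | skip | insert | erase | loop_false => rfl
  | zero j | succ j => exact Function.update_of_ne hc _ _
  | seq _ _ ih1 ih2 => rw [ih2 hc.2, ih1 hc.1]
  | cond_true _ _ ih => exact ih hc.1
  | cond_false _ _ ih => exact ih hc.2
  | loop_true _ _ _ ih1 ih2 => rw [ih2 hc, ih1 hc]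

theorem Triple.seq {P Q R : State → Prop} {c d : Cmd} {S T : ℕ} (hc : Triple M P c S Q)
    (hd : Triple M Q d T R) : Triple M P (.seq c d) (S + T) R := by
  intro st hst
  obtain ⟨k, st', h1, hk, hQ⟩ := hc st hst
  obtain ⟨l, st'', h2, hl, hR⟩ := hd st' hQ
  exact ⟨k + l, st'', .seq h1 h2, by omega, hR⟩

theorem Triple.cond {P Q : State → Prop} {t : Test} {c d : Cmd} {T : ℕ}
    (hc : Triple M (fun st => P st ∧ t.Holds M st) c T Q)
    (hd : Triple M (fun st => P st ∧ ¬ t.Holds M st) d T Q) :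
    Triple M P (.cond t c d) (T + 1) Q := by
  intro st hst
  by_cases ht : t.Holds M st
  · obtain ⟨k, st', h1, hk, hQ⟩ := hc st ⟨hst, ht⟩
    exact ⟨k + 1, st', .cond_true ht h1, by omega, hQ⟩
  · obtain ⟨k, st', h1, hk, hQ⟩ := hd st ⟨hst, ht⟩
    exact ⟨k + 1, st', .cond_false ht h1, by omega, hQ⟩

theorem Triple.conseq {P P' Q Q' : State → Prop} {c : Cmd} {T : ℕ} (h : Triple M P c T Q)
    (hP : ∀ st, P' st → P st) (hQ : ∀ st, Q st → Q' st) : Triple M P' c T Q' := by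
  intro st hst
  obtain ⟨k, st', h1, hk, h2⟩ := h st (hP st hst)
  exact ⟨k, st', h1, hk, hQ st' h2⟩

theorem Triple.skip {P Q : State → Prop} {T : ℕ} (h : ∀ st, P st → Q st) (hT : 1 ≤ T) :
    Triple M P .skip T Q :=
  fun st hst => ⟨1, st, .skip st, hT, h st hst⟩

theorem Triple.insert {P : State → Prop} {Q : (ℕ → Set (Fin n)) → Prop} {T s i : ℕ} {v : Fin n}
    (h : ∀ st, P st → st.idx i = v ∧
      Q (Function.update (st.ev n) s (insert v (st.ev n s)))) (hT : 1 ≤ T) :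
    Triple M P (.insert s i) T (fun st => Q (st.ev n)) := by
  intro st hst
  obtain ⟨hv, hQ⟩ := h st hst
  refine ⟨1, _, .insert s i st, hT, ?_⟩
  convert hQ using 1
  funext r
  ext x
  by_cases hr : r = s
  · subst hr
    simp [State.ev, hv, Fin.ext_iff]
  · simp [State.ev, hr]

theorem Triple.erase {P : State → Prop} {Q : (ℕ → Set (Fin n)) → Prop} {T s i : ℕ} {v : Fin n}
    (h : ∀ st, P st → st.idx i = v ∧
      Q (Function.update (st.ev n) s (st.ev n s \ {v}))) (hT : 1 ≤ T) :
    Triple M P (.erase s i) T (fun st => Q (st.ev n)) := by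
  intro st hst
  obtain ⟨hv, hQ⟩ := h st hst
  refine ⟨1, _, .erase s i st, hT, ?_⟩
  convert hQ using 1
  funext r
  ext x
  by_cases hr : r = s
  · subst hr
    simp [State.ev, hv, Fin.ext_iff]
  · simp [State.ev, hr]

theorem holds_mem {st : State} {s i : ℕ} {v : Fin n} (h : st.idx i = v) :
    (Test.mem s i).Holds M st ↔ v ∈ st.ev n s := by
  simp [Test.Holds, State.ev, h]

theorem holds_enab {st : State} {s i : ℕ} {v : Fin n} (h : st.idx i = v) :
    (Test.enab s i).Holds M st ↔ M.Enables (st.ev n s) v := by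
  simp only [Test.Holds, h, Fin.eta, Fin.is_lt, exists_true_left]
  rfl

theorem holds_circ {st : State} {s i : ℕ} {v : Fin n} (h : st.idx i = v) :
    (Test.circ s i).Holds M st ↔ M.CircEnables (st.ev n s) v := by
  simp only [Test.Holds, h, Fin.eta, Fin.is_lt, exists_true_left]
  rfl

/-- Execute `c` with all event numbers in index register `i`, in increasing order. -/
def forLoop (i : ℕ) (c : Cmd) : Cmd :=
  .seq (.zero i) (.loop (.inRange i) (.seq c (.succ i)))

theorem Triple.forLoop {J : ℕ → (ℕ → Set (Fin n)) → Prop} {i : ℕ} {c : Cmd} {T : ℕ}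
    (hfix : c.Fixes i)
    (hc : ∀ v : Fin n, Triple M (fun st => st.idx i = v ∧ J v (st.ev n)) c T
      (fun st => J (v + 1) (st.ev n))) :
    Triple M (fun st => J 0 (st.ev n)) (forLoop i c) (n * (T + 2) + 2)
      (fun st => J n (st.ev n)) := by
  have key : ∀ m v, v + m = n → Triple M (fun st => st.idx i = v ∧ J v (st.ev n))
      (.loop (.inRange i) (.seq c (.succ i))) (m * (T + 2) + 1) (fun st => J n (st.ev n)) := by
    intro m
    induction m with
    | zero =>
      rintro v hv st ⟨hi, hJ⟩
      refine ⟨1, st, .loop_false ?_, by omega, ?_⟩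
      · simp only [Test.Holds]
        omega
      · obtain rfl : v = n := by omega
        exact hJ
    | succ m ih =>
      rintro v hv st ⟨hi, hJ⟩
      obtain ⟨k, st', h1, hk, hJ'⟩ := hc ⟨v, by omega⟩ st ⟨hi, hJ⟩
      have hi' : st'.idx i = v := (h1.idx_eq hfix).trans hi
      obtain ⟨l, st'', h2, hl, hJ''⟩ := ih (v + 1) (by omega)
        ⟨Function.update st'.idx i (st'.idx i + 1), st'.set⟩ ⟨by simp [hi'], hJ'⟩
      refine ⟨k + 1 + l + 1, st'', .loop_true ?_ (.seq h1 (.succ i st')) h2, ?_, hJ''⟩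
      · simp only [Test.Holds]
        omega
      · rw [add_mul]
        omega
  intro st hst
  obtain ⟨k, st', h1, hk, hJ⟩ := key n 0 (by omega)
    ⟨Function.update st.idx i 0, st.set⟩ ⟨by simp, hst⟩
  exact ⟨1 + k, st', .seq (.zero i st) h1, by omega, hJ⟩

/-- Set register 3 receives the past and the events circularly enabled by set register 2. -/
def baseLoop : Cmd := forLoop 0
  (.cond (.mem 0 0) (.insert 3 0) (.cond (.circ 2 0) (.insert 3 0) (.erase 3 0)))

/-- One pass that adds enabled events to set register 3. -/
def passLoop : Cmd := forLoop 0 (.cond (.enab 3 0) (.insert 3 0) .skip)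

/-- Set register 2 is intersected with set register 3. -/
def interLoop : Cmd := forLoop 0 (.cond (.mem 3 0) .skip (.erase 2 0))

/-- The output is determined from the past and the contents of set register 2. -/
def outputLoop : Cmd := forLoop 0 (.cond (.mem 0 0) .skip
  (.cond (.enab 0 0) (.insert 1 0) (.cond (.circ 2 0) (.insert 1 0) .skip)))

/-- The program that computes the criterion. -/
def criterionProg : Cmd :=
  .seq (forLoop 0 (.insert 2 0))
    (.seq (forLoop 2 (.seq baseLoop (.seq (forLoop 1 passLoop) interLoop))) outputLoop)

/-- The part of the state that the computation of the closure leaves unchanged. -/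
def Frame (X W : Set (Fin n)) (d : ℕ → Set (Fin n)) : Prop :=
  d 0 = X ∧ d 1 = ∅ ∧ d 2 = W

theorem Frame.update_three {X W S : Set (Fin n)} {d : ℕ → Set (Fin n)} (h : Frame X W d) :
    Frame X W (Function.update d 3 S) := by
  simpa [Frame] using h

theorem baseLoop_spec (X W : Set (Fin n)) :
    Triple M (fun st => Frame X W (st.ev n)) baseLoop (n * (3 + 2) + 2)
      (fun st => Frame X W (st.ev n) ∧
        st.ev n 3 = X ∪ {x | M.CircEnables W x}) := by
  refine (Triple.forLoop (J := fun v d => Frame X W d ∧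
    ∀ x : Fin n, (x : ℕ) < v → (x ∈ d 3 ↔ x ∈ X ∨ M.CircEnables W x)) ?_ fun v => ?_).conseq
    (fun st h => ⟨h, by simp⟩) (fun st h => ⟨h.1, Set.ext fun x => h.2 x x.2⟩)
  · simp [Cmd.Fixes]
  have hcase : ∀ (x : Fin n), (x : ℕ) < v + 1 → x = v ∨ (x ≠ v ∧ (x : ℕ) < v) := by
    intro x hx
    rw [Ne, Fin.ext_iff]
    omega
  refine .cond ?_ (.cond ?_ ?_)
  · refine Triple.insert (v := v) (Q := fun d => Frame X W d ∧ ∀ x : Fin n, (x : ℕ) < v + 1 →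
      (x ∈ d 3 ↔ x ∈ X ∨ M.CircEnables W x)) ?_ (by norm_num)
    rintro st ⟨⟨hi, hF, hJ⟩, ht⟩
    rw [holds_mem hi, hF.1] at ht
    refine ⟨hi, hF.update_three, fun x hx => ?_⟩
    rcases hcase x hx with rfl | ⟨h1, h2⟩
    · simp [ht]
    · simp [h1, hJ x h2]
  · refine Triple.insert (v := v) (Q := fun d => Frame X W d ∧ ∀ x : Fin n, (x : ℕ) < v + 1 →
      (x ∈ d 3 ↔ x ∈ X ∨ M.CircEnables W x)) ?_ (by norm_num)
    rintro st ⟨⟨⟨hi, hF, hJ⟩, _⟩, ht⟩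
    rw [holds_circ hi, hF.2.2] at ht
    refine ⟨hi, hF.update_three, fun x hx => ?_⟩
    rcases hcase x hx with rfl | ⟨h1, h2⟩
    · simp [ht]
    · simp [h1, hJ x h2]
  · refine Triple.erase (v := v) (Q := fun d => Frame X W d ∧ ∀ x : Fin n, (x : ℕ) < v + 1 →
      (x ∈ d 3 ↔ x ∈ X ∨ M.CircEnables W x)) ?_ (by norm_num)
    rintro st ⟨⟨⟨hi, hF, hJ⟩, hn⟩, ht⟩
    rw [holds_circ hi, hF.2.2] at ht
    rw [holds_mem hi, hF.1] at hn
    refine ⟨hi, hF.update_three, fun x hx => ?_⟩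
    rcases hcase x hx with rfl | ⟨h1, h2⟩
    · simp [ht, hn]
    · simp [h1, hJ x h2]

theorem passLoop_spec (hM : M.ConflictFree) (X W S : Set (Fin n)) (hS : S ⊆ M.closure W X) :
    Triple M (fun st => Frame X W (st.ev n) ∧ st.ev n 3 = S) passLoop (n * (2 + 2) + 2)
      (fun st => Frame X W (st.ev n) ∧ S ⊆ st.ev n 3 ∧ st.ev n 3 ⊆ M.closure W X ∧
        ∀ x, M.Enables S x → x ∈ st.ev n 3) := by
  set J : ℕ → (ℕ → Set (Fin n)) → Prop := fun v d => Frame X W d ∧ S ⊆ d 3 ∧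
    d 3 ⊆ M.closure W X ∧ ∀ x : Fin n, (x : ℕ) < v → M.Enables S x → x ∈ d 3 with hJdef
  refine (Triple.forLoop (J := J) ?_ fun v => ?_).conseq ?_ ?_
  · simp [Cmd.Fixes]
  · have hcase : ∀ (x : Fin n), (x : ℕ) < v + 1 → x = v ∨ (x : ℕ) < v := by
      intro x hx
      rw [Fin.ext_iff]
      omega
    refine .cond ?_ ?_
    · refine Triple.insert (v := v) (Q := J (v + 1)) ?_ le_rfl
      rintro st ⟨⟨hi, hF, h1, h2, h3⟩, ht⟩
      rw [holds_enab hi] at ht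
      refine ⟨hi, hF.update_three, ?_, ?_, fun x hx hSx => ?_⟩
      · simpa using h1.trans (Set.subset_insert _ _)
      · simpa [Set.insert_subset_iff] using ⟨CES.closure_of_enables ht h2, h2⟩
      · rcases hcase x hx with rfl | h4
        · simp
        · simp [h3 x h4 hSx]
    · refine Triple.skip ?_ le_rfl
      rintro st ⟨⟨hi, hF, h1, h2, h3⟩, ht⟩
      rw [holds_enab hi] at ht
      refine ⟨hF, h1, h2, fun x hx hSx => ?_⟩
      rcases hcase x hx with rfl | h4
      · exact absurd (hSx.mono hM h1) ht
      · exact h3 x h4 hSx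
  · rintro st ⟨hF, rfl⟩
    exact ⟨hF, subset_rfl, hS, by simp⟩
  · rintro st ⟨hF, h1, h2, h3⟩
    exact ⟨hF, h1, h2, fun x hx => h3 x x.2 hx⟩

theorem closureLoop_spec (hM : M.ConflictFree) (X W : Set (Fin n)) :
    Triple M (fun st => Frame X W (st.ev n) ∧ st.ev n 3 = X ∪ {x | M.CircEnables W x})
      (forLoop 1 passLoop) (n * (n * (2 + 2) + 2 + 2) + 2)
      (fun st => Frame X W (st.ev n) ∧ st.ev n 3 = M.closure W X) := by
  set B : Set (Fin n) := X ∪ {x | M.CircEnables W x} with hB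
  have hclosed : ∀ S, B ⊆ S → (∀ x, M.Enables S x → x ∈ S) → M.closure W X ⊆ S := by
    intro S hBS hS x hx
    induction hx with
    | base h => exact hBS (Or.inl h)
    | circ h => exact hBS (Or.inr h)
    | enab Y _ h ih => exact hS _ ⟨hM.cf _, Y, ih, h⟩
  have hBcl : B ⊆ M.closure W X := by
    rintro x (h | h)
    · exact .base h
    · exact .circ h
  refine (Triple.forLoop (J := fun b d => Frame X W d ∧ B ⊆ d 3 ∧ d 3 ⊆ M.closure W X ∧
    (M.closure W X ⊆ d 3 ∨ b ≤ (d 3).ncard)) ?_ fun b => ?_).conseq ?_ ?_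
  · simp [passLoop, forLoop, Cmd.Fixes]
  · rintro st ⟨_, hF, h1, h2, h3⟩
    obtain ⟨k, st', hr, hk, hF', h4, h5, h6⟩ := passLoop_spec hM X W _ h2 st ⟨hF, rfl⟩
    refine ⟨k, st', hr, hk, hF', h1.trans h4, h5, ?_⟩
    by_cases h7 : M.closure W X ⊆ st.ev n 3
    · exact Or.inl (h7.trans h4)
    · right
      obtain ⟨x, hx, hx'⟩ : ∃ x, M.Enables (st.ev n 3) x ∧ x ∉ st.ev n 3 := by
        by_contra hcon
        push Not at hcon
        exact h7 (hclosed _ h1 hcon)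
      have hlt : (st.ev n 3).ncard < (st'.ev n 3).ncard :=
        Set.ncard_lt_ncard ((Set.ssubset_iff_of_subset h4).2 ⟨x, h6 x hx, hx'⟩) (Set.toFinite _)
      have := h3.resolve_left h7
      omega
  · rintro st ⟨hF, h⟩
    exact ⟨hF, h ▸ subset_rfl, h ▸ hBcl, Or.inr (Nat.zero_le _)⟩
  · rintro st ⟨hF, _, h1, h2⟩
    refine ⟨hF, subset_antisymm h1 ?_⟩
    rcases h2 with h2 | h2
    · exact h2
    · rw [Set.eq_of_subset_of_ncard_le (Set.subset_univ (st.ev n 3))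
        (by simpa [Set.ncard_univ] using h2) (Set.toFinite _)]
      exact Set.subset_univ _

theorem interLoop_spec (X W C : Set (Fin n)) :
    Triple M (fun st => Frame X W (st.ev n) ∧ st.ev n 3 = C) interLoop (n * (2 + 2) + 2)
      (fun st => Frame X (W ∩ C) (st.ev n)) := by
  set J : ℕ → (ℕ → Set (Fin n)) → Prop := fun v d => d 0 = X ∧ d 1 = ∅ ∧ d 3 = C ∧
    ∀ x : Fin n, x ∈ d 2 ↔ x ∈ W ∧ ((x : ℕ) < v → x ∈ C) with hJdef
  refine (Triple.forLoop (J := J) ?_ fun v => ?_).conseq ?_ ?_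
  · simp [Cmd.Fixes]
  · have hcase : ∀ (x : Fin n), x = v ∨ (x ≠ v ∧ ((x : ℕ) < v + 1 ↔ (x : ℕ) < v)) := by
      intro x
      rw [Ne, Fin.ext_iff]
      omega
    refine .cond ?_ ?_
    · refine Triple.skip ?_ le_rfl
      rintro st ⟨⟨hi, h0, h1, h3, h2⟩, ht⟩
      rw [holds_mem hi, h3] at ht
      refine ⟨h0, h1, h3, fun x => ?_⟩
      rcases hcase x with rfl | ⟨_, h4⟩
      · simp [h2, ht]
      · rw [h2, h4]
    · refine Triple.erase (v := v) (Q := J (v + 1)) ?_ le_rfl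
      rintro st ⟨⟨hi, h0, h1, h3, h2⟩, ht⟩
      rw [holds_mem hi, h3] at ht
      refine ⟨hi, by simpa using h0, by simpa using h1, by simpa using h3, fun x => ?_⟩
      rcases hcase x with rfl | ⟨h4, h5⟩
      · simp [ht]
      · simp [h2, h4, h5]
  · rintro st ⟨⟨h0, h1, h2⟩, h3⟩
    exact ⟨h0, h1, h3, by simp [h2]⟩
  · rintro st ⟨h0, h1, _, h2⟩
    exact ⟨h0, h1, Set.ext fun x => by simp [h2]⟩

theorem fullLoop_spec (hM : M.ConflictFree) (X : Set (Fin n)) :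
    Triple M (fun st => Frame X Set.univ (st.ev n))
      (forLoop 2 (.seq baseLoop (.seq (forLoop 1 passLoop) interLoop)))
      (n * ((n * (3 + 2) + 2 + (n * (n * (2 + 2) + 2 + 2) + 2 + (n * (2 + 2) + 2))) + 2) + 2)
      (fun st => Frame X (M.full X) (st.ev n)) := by
  refine (Triple.forLoop (J := fun a d => Frame X (d 2) d ∧ M.full X ⊆ d 2 ∧
    (d 2 ⊆ M.closure (d 2) X ∨ a ≤ ((d 2)ᶜ).ncard)) ?_ fun a => ?_).conseq ?_ ?_
  · simp [baseLoop, passLoop, interLoop, forLoop, Cmd.Fixes]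
  · rintro st ⟨_, hF, h1, h2⟩
    set W := st.ev n 2 with hW
    obtain ⟨k, st', hr, hk, h3⟩ := ((baseLoop_spec X W).seq
      ((closureLoop_spec hM X W).seq (interLoop_spec X W (M.closure W X)))) st hF
    have h4 : st'.ev n 2 = W ∩ M.closure W X := h3.2.2
    refine ⟨k, st', hr, hk, ?_⟩
    beta_reduce
    rw [h4]
    refine ⟨h3, Set.subset_inter h1 ((CES.full_subset_closure hM X).trans
      (CES.closure_subset_closure hM h1 (CES.subset_closure M _ _))), ?_⟩
    by_cases h5 : W ⊆ M.closure W X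
    · left
      rwa [Set.inter_eq_left.2 h5]
    · right
      have hlt : Wᶜ.ncard < ((W ∩ M.closure W X)ᶜ).ncard := by
        refine Set.ncard_lt_ncard (compl_lt_compl_iff_lt.2 ?_) (Set.toFinite _)
        exact Set.inter_ssubset_left_iff.2 h5
      have := h2.resolve_left h5
      omega
  · intro st hF
    have h2 := hF.2.2
    exact ⟨⟨hF.1, hF.2.1, rfl⟩, h2 ▸ Set.subset_univ _, Or.inr (Nat.zero_le _)⟩
  · rintro st ⟨hF, h1, h2⟩
    refine ⟨hF.1, hF.2.1, subset_antisymm (CES.subset_full ?_) h1⟩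
    rcases h2 with h2 | h2
    · exact h2
    · have h3 : (st.ev n 2)ᶜ = Set.univ := Set.eq_of_subset_of_ncard_le (Set.subset_univ _)
        (by simpa [Set.ncard_univ] using h2) (Set.toFinite _)
      rw [Set.compl_univ_iff.1 h3]
      exact Set.empty_subset _

theorem outputLoop_spec (X W : Set (Fin n)) :
    Triple M (fun st => Frame X W (st.ev n)) outputLoop (n * (4 + 2) + 2)
      (fun st => st.ev n 1 = {x | x ∉ X ∧ (M.Enables X x ∨ M.CircEnables W x)}) := by
  set J : ℕ → (ℕ → Set (Fin n)) → Prop := fun v d => d 0 = X ∧ d 2 = W ∧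
    ∀ x : Fin n, x ∈ d 1 ↔ (x : ℕ) < v ∧ x ∉ X ∧ (M.Enables X x ∨ M.CircEnables W x) with hJdef
  refine (Triple.forLoop (J := J) ?_ fun v => ?_).conseq ?_ ?_
  · simp [Cmd.Fixes]
  · have hcase : ∀ (x : Fin n), x = v ∨ (x ≠ v ∧ ((x : ℕ) < v + 1 ↔ (x : ℕ) < v)) := by
      intro x
      rw [Ne, Fin.ext_iff]
      omega
    have hskip : ∀ st : State, J v (st.ev n) →
        ¬ (v ∉ X ∧ (M.Enables X v ∨ M.CircEnables W v)) → J (v + 1) (st.ev n) := by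
      rintro st ⟨h0, h2, h1⟩ hn
      refine ⟨h0, h2, fun x => ?_⟩
      rcases hcase x with rfl | ⟨_, h4⟩
      · rw [h1]
        exact iff_of_false (fun h => hn h.2) (fun h => hn h.2)
      · rw [h1, h4]
    have hinsert : ∀ st : State, J v (st.ev n) →
        (v ∉ X ∧ (M.Enables X v ∨ M.CircEnables W v)) →
        J (v + 1) (Function.update (st.ev n) 1 (insert v (st.ev n 1))) := by
      rintro st ⟨h0, h2, h1⟩ hn
      refine ⟨by simpa using h0, by simpa using h2, fun x => ?_⟩
      rcases hcase x with rfl | ⟨h3, h4⟩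
      · simp [hn]
      · simp [h1, h3, h4]
    refine .cond (Triple.skip ?_ (by norm_num)) (.cond (Triple.insert (v := v) ?_ (by norm_num))
      (.cond (Triple.insert (v := v) ?_ (by norm_num)) (Triple.skip ?_ (by norm_num))))
    · rintro st ⟨⟨hi, hJ⟩, ht⟩
      rw [holds_mem hi, hJ.1] at ht
      exact hskip st hJ fun h => h.1 ht
    · rintro st ⟨⟨⟨hi, hJ⟩, hm⟩, ht⟩
      rw [holds_mem hi, hJ.1] at hm
      rw [holds_enab hi, hJ.1] at ht
      exact ⟨hi, hinsert st hJ ⟨hm, Or.inl ht⟩⟩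
    · rintro st ⟨⟨⟨⟨hi, hJ⟩, hm⟩, _⟩, ht⟩
      rw [holds_mem hi, hJ.1] at hm
      rw [holds_circ hi, hJ.2.1] at ht
      exact ⟨hi, hinsert st hJ ⟨hm, Or.inr ht⟩⟩
    · rintro st ⟨⟨⟨⟨hi, hJ⟩, _⟩, hen⟩, ht⟩
      rw [holds_enab hi, hJ.1] at hen
      rw [holds_circ hi, hJ.2.1] at ht
      exact hskip st hJ fun h => h.2.elim hen ht
  · rintro st ⟨h0, h1, h2⟩
    exact ⟨h0, h2, by simp [h1]⟩
  · rintro st ⟨_, _, h1⟩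
    exact Set.ext fun x => by simp [h1]

theorem fillLoop_spec (X : Set (Fin n)) :
    Triple M (fun st => st.ev n 0 = X ∧ st.ev n 1 = ∅) (forLoop 0 (.insert 2 0))
      (n * (1 + 2) + 2) (fun st => Frame X Set.univ (st.ev n)) := by
  set J : ℕ → (ℕ → Set (Fin n)) → Prop := fun v d => d 0 = X ∧ d 1 = ∅ ∧
    ∀ x : Fin n, (x : ℕ) < v → x ∈ d 2 with hJdef
  refine (Triple.forLoop (J := J) ?_ fun v => ?_).conseq ?_ ?_
  · simp [Cmd.Fixes]
  · refine Triple.insert (v := v) (Q := J (v + 1)) ?_ le_rfl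
    rintro st ⟨hi, h0, h1, h2⟩
    refine ⟨hi, by simpa using h0, by simpa using h1, fun x hx => ?_⟩
    rcases eq_or_ne x v with rfl | h
    · simp
    · simp [h2 x (by rw [Ne, Fin.ext_iff] at h; omega)]
  · rintro st ⟨h0, h1⟩
    exact ⟨h0, h1, by simp⟩
  · rintro st ⟨h0, h1, h2⟩
    exact ⟨h0, h1, Set.eq_univ_of_forall fun x => h2 x x.2⟩

end CESProg

theorem CES.criterion_eq {E : Type*} [Finite E] {M : CES E} (hM : M.ConflictFree) (X : Set E) :
    M.criterion X = {x | x ∉ X ∧ (M.Enables X x ∨ M.CircEnables (M.full X) x)} := by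
  have hX : X.Finite := X.toFinite
  have hl : CES.events (hX.toFinset.toList : Stream'.Seq E) = X := by
    ext x
    simp [CES.mem_events_coe]
  have h := fun x => CES.mem_criterion (e := x) hM
    ((CES.isPlay_coe hM).2 hX.toFinset.nodup_toList)
  rw [hl] at h
  ext x
  simp [h]

/-- The running time of `CESProg.criterionProg`, as a polynomial in the number of events. -/
noncomputable def CESProg.criterionTime : Polynomial ℕ :=
  let n : Polynomial ℕ := Polynomial.X
  n * (1 + 2) + 2 +
    (n * ((n * (3 + 2) + 2 + (n * (n * (2 + 2) + 2 + 2) + 2 + (n * (2 + 2) + 2))) + 2) + 2 +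
      (n * (4 + 2) + 2))

theorem CESProg.criterionProg_spec {n : ℕ} {M : CES (Fin n)} (hM : M.ConflictFree)
    (X : Set (Fin n)) : ∃ (k : ℕ) (st : State), Runs M criterionProg (State.init X) k st ∧
      k ≤ criterionTime.eval n ∧ st.output n = M.criterion X := by
  obtain ⟨k, st, hr, hk, hst⟩ := ((fillLoop_spec X).seq
    ((fullLoop_spec hM X).seq (outputLoop_spec X (M.full X)))) (State.init X)
    ⟨by ext x; simp [State.ev, State.init, Fin.val_inj], by ext x; simp [State.ev, State.init]⟩
  refine ⟨k, st, hr, hk.trans (le_of_eq ?_), ?_⟩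
  · simp [criterionTime]
  · rw [CES.criterion_eq hM]
    exact hst

/-- First part: in a conflict-free event structure with circular causality over countably many
events, finitely many of which are circularly enabled, the prudent events in a finite play are
those given by the criterion. Second part: one program computes the criterion on all
conflict-free structures with `n` events, in a number of steps polynomial in `n`. -/
theorem mainTheorem6 :
    (∀ (E : Type*) (A : Type*) [Countable E] (M : CES E) (π : E → A),
      M.ConflictFree →
      {e : E | ∃ Z : Finset E, M.circ Z e}.Finite →
      ∀ σ : List E, M.IsPlay (σ : Stream'.Seq E) → ∀ e : E,
        M.Prudent π σ e ↔ e ∈ M.criterion (CES.events (σ : Stream'.Seq E))) ∧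
    (∃ (prog : CESProg.Cmd) (p : Polynomial ℕ),
      ∀ (n : ℕ) (M : CES (Fin n)), M.ConflictFree →
      ∀ X : Set (Fin n), ∃ (k : ℕ) (st : CESProg.State),
        CESProg.Runs M prog (CESProg.State.init X) k st ∧ k ≤ p.eval n ∧
        st.output n = M.criterion X) :=
  ⟨fun _ _ _ _ _ hM hC _ hσ _ =>
    ⟨fun h => h.mem_criterion hM hC, CES.prudent_of_mem_criterion hM hC _ hσ⟩,
   CESProg.criterionProg, CESProg.criterionTime, fun _ _ hM X => CESProg.criterionProg_spec hM X⟩
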